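/- Let $q=1$ or let $q\ge 2$ be a prime power, and let $0\le k\le n$ and $0\le t\le k$ be integers. If $q=1$, let $V$ be a set of size $n$, and call its subsets subspaces, with rank their cardinality; if $q\ge 2$, let $V$ be an $n$-dimensional vector space over $\mathbb F_q$, with rank of a subspace its dimension. Let $\genfrac{[}{]}{0pt}{}{V}{i}$ be the set of subspaces of $V$ of rank $i$. With $[m]_q=1+q+\dots+q^{m-1}$, let $$\genfrac{[}{]}{0pt}{}{m}{j}_q=\prod_{i=0}^{j-1}\frac{[m-i]_q}{[j-i]_q}$$ be the Gaussian binomial coefficient. The degree of a nonzero function $f:\genfrac{[}{]}{0pt}{}{V}{k}\to\mathbb R$ is the smallest $s\in\{0,\dots,\min(k,n-k)\}$ such that $f$ lies in the linear span of the functions $\boldsymbol x_S$, $S\in\genfrac{[}{]}{0pt}{}{V}{s}$, where $\boldsymbol x_S(K)=1$ if $S\subseteq K$ and $\boldsymbol x_S(K)=0$ otherwise; the zero function has degree $-\infty$. The degree of a set $\mathcal F\subseteq\genfrac{[}{]}{0pt}{}{V}{k}$ is the degree of its characteristic function. Let $m_q(n,k,t)$ be the smallest size $\#\mathcal F$ of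 a nonempty set $\mathcal F\subseteq\genfrac{[}{]}{0pt}{}{V}{k}$ of degree at most $t$. Suppose that $k-i$ divides $n-i$ for all $i\in\{0,\dots,t-1\}$. Then $$\gcd\left(\genfrac{[}{]}{0pt}{}{n}{k}_q,\genfrac{[}{]}{0pt}{}{n-1}{k-1}_q,\dots,\genfrac{[}{]}{0pt}{}{n-t}{k-t}_q\right)=\genfrac{[}{]}{0pt}{}{n-t}{k-t}_q .$$ If moreover $k\le\frac n2$, then $$m_q(n,k,t)=\genfrac{[}{]}{0pt}{}{n-t}{k-t}_q ,$$ and for $t\ge 1$ this number is also the smallest size of a set $\mathcal F\subseteq\genfrac{[}{]}{0pt}{}{V}{k}$ of degree at most $t$ with $\mathcal F\ne\emptyset$ and $\mathcal F\neq\genfrac{[}{]}{0pt}{}{V}{k}$. -/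

import Mathlib

noncomputable section

namespace CameronLiebler

/-- The `q`-number `[n]_q = 1 + q + ⋯ + q^(n-1)`, for natural numbers `n` and `q`. -/
def qNum (q n : ℕ) : ℕ := ∑ i ∈ Finset.range n, q ^ i

/-- The falling `q`-factorial `∏_{i<k} [n-i]_q`. For `k > n` the factor with `i = n` is
`[0]_q = 0`, so the truncation of the subtraction does no harm. -/
def qDescFactorial (q n k : ℕ) : ℕ := ∏ i ∈ Finset.range k, qNum q (n - i)

/-- The `q`-factorial `[k]_q!`. -/
def qFactorial (q k : ℕ) : ℕ := qDescFactorial q k k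

/-- The Gaussian binomial coefficient, for natural numbers `n` and `k`. The division is exact,
see `qFactorial_dvd_qDescFactorial` and `qFactorial_pos`. -/
def qBinom (q n k : ℕ) : ℕ := qDescFactorial q n k / qFactorial q k

theorem qNum_add (q a b : ℕ) : qNum q (a + b) = qNum q a + q ^ a * qNum q b := by
  simp [qNum, Finset.sum_range_add, Finset.mul_sum, pow_add]

theorem qFactorial_pos (q k : ℕ) : 0 < qFactorial q k := by
  unfold qFactorial qDescFactorial
  refine Finset.prod_pos fun i hi => ?_
  obtain ⟨m, hm⟩ : ∃ m, k - i = m + 1 := ⟨k - i - 1, by have := Finset.mem_range.1 hi; omega⟩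
  rw [hm, qNum, Finset.sum_range_succ', pow_zero]
  exact Nat.succ_pos _

theorem qDescFactorial_succ_succ (q n k : ℕ) :
    qDescFactorial q (n + 1) (k + 1) = qDescFactorial q n k * qNum q (n + 1) := by
  simp [qDescFactorial, Finset.prod_range_succ']

theorem qFactorial_dvd_qDescFactorial (q n k : ℕ) :
    qFactorial q k ∣ qDescFactorial q n k := by
  induction n generalizing k with
  | zero =>
    cases k with
    | zero => exact dvd_rfl
    | succ k => simp [qDescFactorial, qNum]
  | succ n ih =>
    cases k with
    | zero => simp [qFactorial, qDescFactorial]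
    | succ k =>
      rcases Nat.lt_or_ge n k with h | h
      · have h0 : qDescFactorial q (n + 1) (k + 1) = 0 :=
          Finset.prod_eq_zero (i := n + 1) (Finset.mem_range.2 (by omega)) (by simp [qNum])
        rw [h0]
        exact dvd_zero _
      · have e : n + 1 = (k + 1) + (n - k) := by omega
        have e2 : qDescFactorial q n (k + 1) = qDescFactorial q n k * qNum q (n - k) :=
          Finset.prod_range_succ _ _
        have e3 : qDescFactorial q (n + 1) (k + 1) = qDescFactorial q n k * qNum q (k + 1)
            + q ^ (k + 1) * qDescFactorial q n (k + 1) := by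
          rw [qDescFactorial_succ_succ, e2]
          conv_lhs => rw [e, qNum_add]
          ring
        rw [e3]
        refine dvd_add ?_ ((ih (k + 1)).mul_left _)
        rw [qFactorial, qDescFactorial_succ_succ]
        exact Nat.mul_dvd_mul_right (ih k) _

/-- The set of elements of rank `k` of a poset `L` with rank function `rk`. For `L` the lattice of
all subsets of a finite set and `rk` the cardinality these are the `k`-subsets; for `L` the lattice
of all subspaces of a finite vector space and `rk` the dimension these are the `k`-subspaces. -/
abbrev Layer {L : Type*} (rk : L → ℕ) (k : ℕ) : Type _ := {U : L // rk U = k}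

open Classical in
/-- The incidence matrix of the elements of rank `x` versus the elements of rank `y`. -/
def incMatrix {L : Type*} [PartialOrder L] (rk : L → ℕ) (x y : ℕ) :
    Matrix (Layer rk x) (Layer rk y) ℝ :=
  Matrix.of fun X Y => if X.1 ≤ Y.1 then 1 else 0

/-- The row space of the incidence matrix of rank `i` versus rank `k`, that is, the linear span of
the characteristic functions of the `i`-pencils. -/
def rowSpace {L : Type*} [PartialOrder L] (rk : L → ℕ) (k i : ℕ) :
    Submodule ℝ (Layer rk k → ℝ) :=
  Submodule.span ℝ (Set.range fun I : Layer rk i => incMatrix rk i k I)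

open Classical in
/-- The degree of a real function `f` on the elements of rank `k`: it is `-∞` for `f = 0`, and
otherwise the smallest `t ∈ {0, …, min (k, n - k)}` such that `f` lies in the row space of index
`t`, where `n = rk ⊤` is the rank of the ambient space. -/
def degree {L : Type*} [PartialOrder L] [OrderTop L] (rk : L → ℕ) (k : ℕ)
    (f : Layer rk k → ℝ) : WithBot ℕ :=
  if f = 0 then ⊥
  else ((sInf {t : ℕ | t ≤ min k (rk ⊤ - k) ∧ f ∈ rowSpace rk k t} : ℕ) : WithBot ℕ)

/-- The degree of a set of elements of rank `k`, that is, of its characteristic function. -/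
def setDegree {L : Type*} [PartialOrder L] [OrderTop L] (rk : L → ℕ) (k : ℕ)
    (𝓕 : Set (Layer rk k)) : WithBot ℕ :=
  degree rk k (𝓕.indicator 1)

/-- The sizes of the nonempty sets of elements of rank `k` of degree at most `t`. -/
def nonemptySizes {L : Type*} [PartialOrder L] [OrderTop L] (rk : L → ℕ) (k t : ℕ) : Set ℕ :=
  {m | ∃ 𝓕 : Set (Layer rk k), 𝓕 ≠ ∅ ∧ setDegree rk k 𝓕 ≤ (t : WithBot ℕ) ∧ 𝓕.ncard = m}

/-- The sizes of the sets of elements of rank `k` of degree at most `t` which are neither empty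
nor the set of all elements of rank `k`. -/
def properSizes {L : Type*} [PartialOrder L] [OrderTop L] (rk : L → ℕ) (k t : ℕ) : Set ℕ :=
  {m | ∃ 𝓕 : Set (Layer rk k),
    𝓕 ≠ ∅ ∧ 𝓕 ≠ Set.univ ∧ setDegree rk k 𝓕 ≤ (t : WithBot ℕ) ∧ 𝓕.ncard = m}

/-- The rank function of the lattice of subsets of a finite set. -/
def setRank (V : Type*) : Finset V → ℕ := Finset.card

/-- The rank function of the lattice of subspaces of a vector space. -/
def spaceRank (F V : Type*) [Field F] [AddCommGroup V] [Module F V] : Submodule F V → ℕ :=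
  fun U => Module.finrank F U

end CameronLiebler

end

noncomputable section

namespace CameronLiebler

open Finset

/-! The minimum follows from a divisibility: a nonempty set of degree `s ≤ t` has size divisible by
`[n-s choose k-s]`, hence by `[n-t choose k-t]`; the pencil of an element of rank `t` has exactly
this size.

Write the characteristic function as `∑ c_T x_T` over `T` of rank `s`. Double counting gives the
size as `[n-s choose k-s] * ∑ c_T`. Since the Gaussian binomial is coprime to `q`, it is enough that
`∑ c_T` lies in `R = ℤ[1/q]` (`IsPivotMap.sum_coeff_mem`).

For this, fix a complete flag and sum over Schubert cells. Up to powers of `q`, which are units of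
`R`, this replaces subspaces by subsets of `range n`, with the incidence of `B` and `A` weighted by
`q ^ inversions B (A \ B)` if `B ⊆ A`. Sets are the case `q = 1`, with one set in each cell.

In this weighted Boolean lattice, integrality of all the sums over the `k`-sets forces the
coefficients to be `∑ a_U / [k-#U choose t-#U] * weight q U B` with `a_U ∈ R` and `#U ≤ t`
(`exists_coeff_of_sum_weight_mem`). The total sum is then an `R`-combination of the quotients `[n-#U
choose t-#U] / [k-#U choose t-#U]`, which are products of `[n-j] / [k-j]` and so integers by the
divisibility condition (`sum_weight_mem`). -/

/-! ### Arithmetic of Gaussian binomial coefficients. -/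

theorem qNum_pos {q m : ℕ} (hm : 0 < m) : 0 < qNum q m := by
  obtain ⟨m, rfl⟩ := Nat.exists_eq_succ_of_ne_zero hm.ne'
  rw [qNum, Finset.sum_range_succ', pow_zero]
  exact Nat.succ_pos _

theorem qNum_dvd_qNum {q a b : ℕ} (h : a ∣ b) : qNum q a ∣ qNum q b := by
  obtain ⟨c, rfl⟩ := h
  induction c with
  | zero => simp [qNum]
  | succ c ih =>
    rw [Nat.mul_succ, qNum_add]
    exact dvd_add ih (Dvd.intro_left _ rfl)

theorem coprime_qNum {q m : ℕ} (hm : 0 < m) : Nat.Coprime q (qNum q m) := by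
  obtain ⟨m, rfl⟩ := Nat.exists_eq_succ_of_ne_zero hm.ne'
  rw [qNum, Finset.sum_range_succ', pow_zero]
  have : ∑ i ∈ range m, q ^ (i + 1) = q * ∑ i ∈ range m, q ^ i := by
    rw [Finset.mul_sum]; exact Finset.sum_congr rfl fun i _ => pow_succ' q i
  rw [this]
  simp

theorem qBinom_mul_qFactorial (q n k : ℕ) :
    qBinom q n k * qFactorial q k = qDescFactorial q n k :=
  Nat.div_mul_cancel (qFactorial_dvd_qDescFactorial q n k)

theorem qBinom_zero_right (q n : ℕ) : qBinom q n 0 = 1 := by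
  simp [qBinom, qDescFactorial, qFactorial]

theorem qDescFactorial_eq_zero {q n k : ℕ} (h : n < k) : qDescFactorial q n k = 0 :=
  Finset.prod_eq_zero (i := n) (Finset.mem_range.2 h) (by simp [qNum])

theorem qBinom_eq_zero {q n k : ℕ} (h : n < k) : qBinom q n k = 0 := by
  simp [qBinom, qDescFactorial_eq_zero h]

theorem qDescFactorial_pos {q n k : ℕ} (h : k ≤ n) : 0 < qDescFactorial q n k :=
  Finset.prod_pos fun i hi => qNum_pos (by have := Finset.mem_range.1 hi; omega)

theorem qBinom_pos {q n k : ℕ} (h : k ≤ n) : 0 < qBinom q n k :=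
  Nat.div_pos (Nat.le_of_dvd (qDescFactorial_pos h) (qFactorial_dvd_qDescFactorial q n k))
    (qFactorial_pos q k)

theorem coprime_qBinom {q n k : ℕ} (h : k ≤ n) : Nat.Coprime q (qBinom q n k) := by
  refine Nat.Coprime.coprime_dvd_right (Dvd.intro _ (qBinom_mul_qFactorial q n k)) ?_
  exact Nat.Coprime.prod_right fun i hi =>
    coprime_qNum (by have := Finset.mem_range.1 hi; omega)

theorem qBinom_succ_mul (q n k : ℕ) :
    qBinom q (n + 1) (k + 1) * qNum q (k + 1) = qBinom q n k * qNum q (n + 1) := by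
  have h1 := qBinom_mul_qFactorial q (n + 1) (k + 1)
  have h2 := qBinom_mul_qFactorial q n k
  rw [qDescFactorial_succ_succ, ← h2, qFactorial, qDescFactorial_succ_succ] at h1
  refine Nat.eq_of_mul_eq_mul_right (qFactorial_pos q k) ?_
  rw [qFactorial] at *
  linarith

theorem qBinom_succ_succ {q n k : ℕ} (h : k ≤ n) :
    qBinom q (n + 1) (k + 1) = qBinom q n (k + 1) + q ^ (n - k) * qBinom q n k := by
  refine Nat.eq_of_mul_eq_mul_right (qFactorial_pos q (k + 1)) ?_
  have e2 : qDescFactorial q n (k + 1) = qDescFactorial q n k * qNum q (n - k) :=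
    Finset.prod_range_succ _ _
  have e : n + 1 = (n - k) + (k + 1) := by omega
  rw [add_mul, mul_assoc, qBinom_mul_qFactorial, qBinom_mul_qFactorial, qFactorial,
    qDescFactorial_succ_succ q k k, ← mul_assoc (qBinom q n k), ← qFactorial,
    qBinom_mul_qFactorial, qDescFactorial_succ_succ, e2]
  conv_lhs => rw [e, qNum_add]
  ring

/-- One more step of divisibility in both parameters of the Gaussian binomial coefficient. -/
theorem qBinom_dvd_qBinom_sub {q n k i t : ℕ} (hit : i ≤ t) (htk : t ≤ k) (hkn : k ≤ n)
    (hdiv : ∀ j, i ≤ j → j < t → k - j ∣ n - j) :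
    qBinom q (n - t) (k - t) ∣ qBinom q (n - i) (k - i) := by
  induction t, hit using Nat.le_induction with
  | base => exact dvd_rfl
  | succ t hit ih =>
    refine dvd_trans ?_ (ih (by omega) fun j hj hjt => hdiv j hj (by omega))
    obtain ⟨a, ha⟩ : ∃ a, k - t = a + 1 := ⟨k - t - 1, by omega⟩
    obtain ⟨b, hb⟩ : ∃ b, n - t = b + 1 := ⟨n - t - 1, by omega⟩
    -- The quotient of the two consecutive binomials is `[n-t] / [k-t]`.
    obtain ⟨d, hd⟩ := qNum_dvd_qNum (q := q) (hdiv t hit (by omega))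
    have h := qBinom_succ_mul q b a
    rw [← ha, ← hb, hd] at h
    rw [show k - (t + 1) = a by omega, show n - (t + 1) = b by omega]
    refine ⟨d, Nat.eq_of_mul_eq_mul_right (qNum_pos (q := q) (m := k - t) (by omega)) ?_⟩
    rw [h]; ring

/-- The quotient is the product of `[n-j] / [k-j]` over `i ≤ j < t`, and each factor is an integer.
-/
theorem qBinom_sub_dvd_qBinom_sub {q n k i t : ℕ}
    (hdiv : ∀ j, i ≤ j → j < t → k - j ∣ n - j) :
    qBinom q (k - i) (t - i) ∣ qBinom q (n - i) (t - i) := by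
  refine Nat.dvd_of_mul_dvd_mul_right (qFactorial_pos q (t - i)) ?_
  rw [qBinom_mul_qFactorial, qBinom_mul_qFactorial]
  refine Finset.prod_dvd_prod_of_dvd _ _ fun j hj => qNum_dvd_qNum ?_
  have := Finset.mem_range.1 hj
  have := hdiv (i + j) (by omega) (by omega)
  rwa [Nat.sub_sub, Nat.sub_sub]

theorem gcd_qBinom {n k t : ℕ} (q : ℕ) (hkn : k ≤ n) (htk : t ≤ k)
    (hdiv : ∀ i < t, k - i ∣ n - i) :
    (Finset.range (t + 1)).gcd (fun i => qBinom q (n - i) (k - i))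
      = qBinom q (n - t) (k - t) :=
  Nat.dvd_antisymm (Finset.gcd_dvd (by simp))
    (Finset.dvd_gcd fun i hi => qBinom_dvd_qBinom_sub
      (by have := Finset.mem_range.1 hi; omega) htk hkn fun j _ hj => hdiv j hj)

/-! ### Inversions as the statistic behind Gaussian binomials. -/

/-- The number of pairs in `X × Y` which are in decreasing order. -/
def inversions (X Y : Finset ℕ) : ℕ := #{p ∈ X ×ˢ Y | p.2 < p.1}

theorem inversions_union_left {X X' : Finset ℕ} (Y : Finset ℕ) (h : Disjoint X X') :
    inversions (X ∪ X') Y = inversions X Y + inversions X' Y := by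
  rw [inversions, union_product, filter_union, card_union_of_disjoint]
  · rfl
  · exact disjoint_filter_filter (disjoint_product.2 (Or.inl h))

theorem inversions_union_right {Y Y' : Finset ℕ} (X : Finset ℕ) (h : Disjoint Y Y') :
    inversions X (Y ∪ Y') = inversions X Y + inversions X Y' := by
  rw [inversions, product_union, filter_union, card_union_of_disjoint]
  · rfl
  · exact disjoint_filter_filter (disjoint_product.2 (Or.inr h))

@[simp] theorem inversions_empty_left (Y : Finset ℕ) : inversions ∅ Y = 0 := by
  simp [inversions]

@[simp] theorem inversions_empty_right (X : Finset ℕ) : inversions X ∅ = 0 := by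
  simp [inversions]

theorem inversions_insert_right {m : ℕ} {X Y : Finset ℕ} (hX : ∀ x ∈ X, x < m) :
    inversions X (insert m Y) = inversions X Y := by
  unfold inversions
  congr 1
  ext ⟨x, y⟩
  simp only [mem_filter, mem_product, mem_insert]
  constructor
  · rintro ⟨⟨hx, rfl | hy⟩, h⟩
    · exact absurd (hX x hx) (by omega)
    · exact ⟨⟨hx, hy⟩, h⟩
  · rintro ⟨⟨hx, hy⟩, h⟩
    exact ⟨⟨hx, Or.inr hy⟩, h⟩

theorem inversions_insert_left {m : ℕ} {X Y : Finset ℕ} (hX : ∀ x ∈ X, x < m)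
    (hY : ∀ y ∈ Y, y < m) : inversions (insert m X) Y = #Y + inversions X Y := by
  rw [insert_eq, inversions_union_left]
  · congr 1
    rw [inversions, filter_true_of_mem, card_product, card_singleton, one_mul]
    rintro ⟨x, y⟩ h
    simp only [mem_product, mem_singleton] at h
    rw [h.1]; exact hY y h.2
  · rw [disjoint_singleton_left]
    exact fun h => (hX m h).false

/-- The Gaussian binomial coefficient counts subsets by their inversions. -/
theorem sum_pow_inversions (q : ℕ) (C : Finset ℕ) (j : ℕ) :
    ∑ X ∈ powersetCard j C, q ^ inversions X (C \ X) = qBinom q #C j := by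
  induction C using Finset.induction_on_max generalizing j with
  | empty =>
    cases j with
    | zero => simp [qBinom_zero_right]
    | succ j => rw [powersetCard_eq_empty.2 (by simp), sum_empty, qBinom_eq_zero (by simp)]
  | insert m C hm ih =>
    have hmC : m ∉ C := fun h => (hm m h).false
    cases j with
    | zero => simp [qBinom_zero_right]
    | succ j =>
      rw [powersetCard_succ_insert hmC, sum_union, card_insert_of_notMem hmC]
      · have h1 : ∑ X ∈ powersetCard (j + 1) C, q ^ inversions X (insert m C \ X)
            = qBinom q #C (j + 1) := by
          rw [← ih]
          refine sum_congr rfl fun X hX => ?_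
          have hXC := (mem_powersetCard.1 hX).1
          rw [insert_sdiff_of_notMem _ fun h => hmC (hXC h),
            inversions_insert_right fun x hx => hm x (hXC hx)]
        have h2 : ∑ X ∈ (powersetCard j C).image (insert m), q ^ inversions X (insert m C \ X)
            = q ^ (#C - j) * qBinom q #C j := by
          rw [sum_image, ← ih, mul_sum]
          · refine sum_congr rfl fun X hX => ?_
            obtain ⟨hXC, hc⟩ := mem_powersetCard.1 hX
            have e : insert m C \ insert m X = C \ X := by
              rw [insert_sdiff_insert, sdiff_insert_of_notMem hmC]
            rw [e, inversions_insert_left (fun x hx => hm x (hXC hx))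
              (fun y hy => hm y (sdiff_subset hy)), card_sdiff_of_subset hXC, hc, pow_add]
          · intro X hX Y hY h
            have hX' := fun h => hmC ((mem_powersetCard.1 hX).1 h)
            have hY' := fun h => hmC ((mem_powersetCard.1 hY).1 h)
            rw [← erase_insert hX', ← erase_insert hY', h]
        rw [h1, h2]
        rcases le_or_gt j #C with h | h
        · rw [qBinom_succ_succ h]
        · rw [qBinom_eq_zero (q := q) h, qBinom_eq_zero (q := q) (show #C < j + 1 by omega),
            qBinom_eq_zero (by omega), mul_zero, add_zero]
      · rw [disjoint_left]
        intro X hX hX'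
        obtain ⟨Y, -, rfl⟩ := mem_image.1 hX'
        exact hmC ((mem_powersetCard.1 hX).1 (mem_insert_self _ _))

/-! ### The weighted incidence matrices of the Boolean lattice. -/

/-- The number of subspaces with pivot set `B` of a subspace with pivot set `A`. -/
def weight (q : ℕ) (B A : Finset ℕ) : ℝ :=
  if B ⊆ A then (q : ℝ) ^ inversions B (A \ B) else 0

theorem weight_of_subset {q : ℕ} {B A : Finset ℕ} (h : B ⊆ A) :
    weight q B A = (q : ℝ) ^ inversions B (A \ B) := if_pos h

theorem weight_of_not_subset {q : ℕ} {B A : Finset ℕ} (h : ¬ B ⊆ A) :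
    weight q B A = 0 := if_neg h

@[simp] theorem weight_self (q : ℕ) (A : Finset ℕ) : weight q A A = 1 := by
  simp [weight_of_subset]

@[simp] theorem weight_empty (q : ℕ) (A : Finset ℕ) : weight q ∅ A = 1 := by
  simp [weight_of_subset]

theorem weight_insert_right {q m : ℕ} {B A : Finset ℕ} (hB : B ⊆ range m) :
    weight q B (insert m A) = weight q B A := by
  have hm : m ∉ B := fun h => by simpa using hB h
  unfold weight
  rw [insert_sdiff_of_notMem _ hm, inversions_insert_right fun x hx => mem_range.1 (hB hx)]
  simp only [subset_insert_iff_of_notMem hm]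

theorem weight_insert_left {q m : ℕ} {B A : Finset ℕ} (hA : A ⊆ range m) :
    weight q (insert m B) A = 0 :=
  weight_of_not_subset fun h => by simpa using hA (h (mem_insert_self _ _))

theorem weight_insert_insert {q m : ℕ} {B A : Finset ℕ} (hB : B ⊆ range m) (hA : A ⊆ range m) :
    weight q (insert m B) (insert m A) = (q : ℝ) ^ (#A - #B) * weight q B A := by
  have hmB : m ∉ B := fun h => by simpa using hB h
  have hmA : m ∉ A := fun h => by simpa using hA h
  by_cases h : B ⊆ A
  · rw [weight_of_subset h, weight_of_subset (insert_subset_insert _ h), insert_sdiff_insert,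
      sdiff_insert_of_notMem hmA, inversions_insert_left (fun x hx => mem_range.1 (hB hx))
        (fun y hy => mem_range.1 (hA (sdiff_subset hy))), card_sdiff_of_subset h, pow_add]
  · rw [weight_of_not_subset h, weight_of_not_subset, mul_zero]
    rwa [insert_subset_insert_iff hmB]

/-- Write `T = U ∪ X`. The exponents of the two weights add up to `inversions U (A \ U)`, which is
independent of `X`, plus the inversions between `X` and `(A \ U) \ X`, so `sum_pow_inversions` gives
the binomial. -/
theorem sum_weight_mul_weight {q t : ℕ} {U A C : Finset ℕ} (hU : #U ≤ t) (hA : A ⊆ C) :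
    ∑ T ∈ powersetCard t C, weight q U T * weight q T A
      = qBinom q (#A - #U) (t - #U) * weight q U A := by
  by_cases hUA : U ⊆ A
  · rw [weight_of_subset hUA, ← card_sdiff_of_subset hUA, ← sum_pow_inversions]
    push_cast
    rw [sum_mul]
    symm
    refine sum_of_injOn (fun X => U ∪ X) ?_ ?_ ?_ ?_
    · intro X hX Y hY h
      have hX' := (mem_powersetCard.1 hX).1
      have hY' := (mem_powersetCard.1 hY).1
      have e : ∀ Z ⊆ A \ U, (U ∪ Z) \ U = Z := fun Z hZ => by
        rw [union_sdiff_left, sdiff_eq_self_of_disjoint]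
        exact (disjoint_sdiff.mono_right hZ).symm
      rw [← e X hX', ← e Y hY']
      exact congrArg (· \ U) h
    · intro X hX
      obtain ⟨hX, hc⟩ := mem_powersetCard.1 hX
      refine mem_powersetCard.2 ⟨?_, ?_⟩
      · exact (union_subset hUA (hX.trans sdiff_subset)).trans hA
      · rw [card_union_of_disjoint (disjoint_sdiff.mono_right hX), hc]; omega
    · intro T hT hT'
      by_contra hne
      have h1 : U ⊆ T := by
        by_contra h; exact hne (by rw [weight_of_not_subset h, zero_mul])
      have h2 : T ⊆ A := by
        by_contra h; exact hne (by rw [weight_of_not_subset h, mul_zero])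
      refine hT' ⟨T \ U, ?_, union_sdiff_of_subset h1⟩
      refine mem_powersetCard.2 ⟨sdiff_subset_sdiff h2 subset_rfl, ?_⟩
      rw [card_sdiff_of_subset h1, (mem_powersetCard.1 hT).2]
    · intro X hX
      obtain ⟨hX, hc⟩ := mem_powersetCard.1 hX
      have hd : Disjoint U X := disjoint_sdiff.mono_right hX
      have hXA : U ∪ X ⊆ A := union_subset hUA (hX.trans sdiff_subset)
      have e1 : (U ∪ X) \ U = X := by
        rw [union_sdiff_left, sdiff_eq_self_of_disjoint hd.symm]
      have e2 : A \ (U ∪ X) = (A \ U) \ X := by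
        ext x; simp only [mem_sdiff, mem_union]; tauto
      rw [weight_of_subset subset_union_left, weight_of_subset hXA, e1, e2,
        inversions_union_left _ hd, ← pow_add, ← pow_add]
      congr 1
      have e3 : A \ U = X ∪ (A \ U) \ X := (union_sdiff_of_subset hX).symm
      conv_lhs => rw [e3]
      rw [inversions_union_right _ disjoint_sdiff, ← e3]
      ring
  · rw [weight_of_not_subset hUA, mul_zero]
    refine sum_eq_zero fun T _ => ?_
    by_cases h : U ⊆ T
    · rw [weight_of_not_subset fun h' => hUA (h.trans h'), mul_zero]
    · rw [weight_of_not_subset h, zero_mul]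

theorem notMem_of_subset_range {m : ℕ} {B : Finset ℕ} (h : B ⊆ range m) : m ∉ B :=
  fun h' => by simpa using h h'

theorem sum_powersetCard_range_succ (m k : ℕ) (f : Finset ℕ → ℝ) :
    ∑ B ∈ powersetCard (k + 1) (range (m + 1)), f B
      = ∑ B ∈ powersetCard (k + 1) (range m), f B
        + ∑ B ∈ powersetCard k (range m), f (insert m B) := by
  have hm : m ∉ range m := by simp
  rw [range_add_one, powersetCard_succ_insert hm, sum_union, sum_image]
  · intro X hX Y hY h
    rw [← erase_insert (notMem_of_subset_range (mem_powersetCard.1 hX).1),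
      ← erase_insert (notMem_of_subset_range (mem_powersetCard.1 hY).1), h]
  · rw [disjoint_left]
    intro X hX hX'
    obtain ⟨Y, -, rfl⟩ := mem_image.1 hX'
    exact hm ((mem_powersetCard.1 hX).1 (mem_insert_self _ _))

theorem sum_powerset_range_succ (m : ℕ) (f : Finset ℕ → ℝ) :
    ∑ B ∈ powerset (range (m + 1)), f B
      = ∑ B ∈ powerset (range m), f B + ∑ B ∈ powerset (range m), f (insert m B) := by
  rw [range_add_one, sum_powerset_insert (by simp)]

theorem mem_powersetCard_range_succ {m k : ℕ} {A : Finset ℕ}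
    (hA : A ∈ powersetCard (k + 1) (range (m + 1))) :
    A ∈ powersetCard (k + 1) (range m) ∨
      ∃ A' ∈ powersetCard k (range m), A = insert m A' := by
  rw [range_add_one, powersetCard_succ_insert (by simp), mem_union, mem_image] at hA
  exact hA.imp id fun ⟨A', h, h'⟩ => ⟨A', h, h'.symm⟩

theorem insert_mem_powersetCard_range {m k : ℕ} {A : Finset ℕ}
    (hA : A ∈ powersetCard k (range m)) :
    insert m A ∈ powersetCard (k + 1) (range (m + 1)) := by
  rw [range_add_one, powersetCard_succ_insert (by simp), mem_union, mem_image]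
  exact Or.inr ⟨A, hA, rfl⟩

theorem mem_powersetCard_range_of_le {m k : ℕ} {A : Finset ℕ}
    (hA : A ∈ powersetCard k (range m)) : A ∈ powersetCard k (range (m + 1)) :=
  powersetCard_mono (range_mono (Nat.le_succ m)) hA

/-! ### Integral coefficients in the weighted Boolean lattice. -/

section Weights

variable {R : Subring ℝ} {q : ℕ}

theorem weight_mem (S A : Finset ℕ) : weight q S A ∈ R := by
  unfold weight
  split_ifs
  · exact R.pow_mem (natCast_mem R q) _
  · exact R.zero_mem

/-- Every function on the `k`-subsets of `range m` is an integral combination of weights of sets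
of size at most `m - k`, over any ring in which `q` is invertible. -/
theorem exists_eq_sum_weight (hq : 0 < q) (hR : (q : ℝ)⁻¹ ∈ R) {m k : ℕ} (hk : k ≤ m)
    (φ : Finset ℕ → ℝ) (hφ : ∀ A ∈ powersetCard k (range m), φ A ∈ R) :
    ∃ a : Finset ℕ → ℝ, (∀ S, a S ∈ R) ∧ (∀ S, a S ≠ 0 → #S + k ≤ m) ∧
      ∀ A ∈ powersetCard k (range m), φ A = ∑ S ∈ powerset (range m), a S * weight q S A := by
  have hq0 : (q : ℝ) ≠ 0 := by exact_mod_cast hq.ne'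
  -- For `k = 0` and `k = m` there is only one `k`-set, and `S = ∅`, whose weight is always `1`,
  -- suffices.
  have const : ∀ m k A₀, k ≤ m → powersetCard k (range m) = {A₀} → ∀ φ : Finset ℕ → ℝ,
      (∀ A ∈ powersetCard k (range m), φ A ∈ R) →
      ∃ a : Finset ℕ → ℝ, (∀ S, a S ∈ R) ∧ (∀ S, a S ≠ 0 → #S + k ≤ m) ∧
      ∀ A ∈ powersetCard k (range m),
        φ A = ∑ S ∈ powerset (range m), a S * weight q S A := by
    intro m k A₀ hk h φ hφ
    refine ⟨fun S => if S = ∅ then φ A₀ else 0, fun S => ?_, fun S => ?_, fun A hA => ?_⟩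
    · dsimp only
      split_ifs
      · exact hφ _ (h ▸ mem_singleton_self _)
      · exact R.zero_mem
    · dsimp only
      split_ifs with h'
      · rw [h']; simpa using fun _ => hk
      · exact fun h => absurd rfl h
    · rw [h, mem_singleton] at hA
      rw [sum_eq_single ∅ (fun S _ hS => by simp [hS]) (fun h => by simp at h), hA]
      simp
  induction m generalizing k φ with
  | zero =>
    obtain rfl : k = 0 := by omega
    exact const 0 0 ∅ le_rfl (by simp) φ hφ
  | succ m ih =>
    cases k with
    | zero => exact const _ _ ∅ hk (by simp) φ hφ
    | succ k =>
      rcases eq_or_ne k m with rfl | hkm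
      · refine const _ _ (range (k + 1)) hk ?_ φ hφ
        have := powersetCard_self (range (k + 1))
        rwa [card_range] at this
      -- `a₁` fits the values on the sets containing `m`; `a₂` fits the error that remains on the
      -- sets avoiding `m`.
      obtain ⟨a₁, h₁R, h₁c, h₁⟩ := ih (k := k) (by omega) (fun A => φ (insert m A))
        fun A hA => hφ _ (insert_mem_powersetCard_range hA)
      obtain ⟨a₂, h₂R, h₂c, h₂⟩ := ih (k := k + 1) (by omega)
        (fun A => φ A - ∑ S ∈ powerset (range m), a₁ S * weight q S A)
        fun A hA => R.sub_mem (hφ _ (mem_powersetCard_range_of_le hA))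
          (R.sum_mem fun S _ => R.mul_mem (h₁R S) (weight_mem _ _))
      -- The correction by `a₂ S` must not disturb the sets containing `m`. The term at `insert m S`
      -- cancels it there, since `insert m` multiplies the weight by `q ^ (k - #S)`, and vanishes on
      -- the sets avoiding `m`.
      refine ⟨fun T => if m ∈ T then -(a₂ (T.erase m) * (q : ℝ)⁻¹ ^ (k - #(T.erase m)))
        else a₁ T + a₂ T, fun T => ?_, fun T => ?_, fun A hA => ?_⟩
      · dsimp only
        split_ifs
        · exact R.neg_mem (R.mul_mem (h₂R _) (R.pow_mem hR _))
        · exact R.add_mem (h₁R _) (h₂R _)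
      · dsimp only
        split_ifs with h
        · intro h0
          have := h₂c (T.erase m) fun h' => h0 (by rw [h']; simp)
          rw [card_erase_of_mem h] at this
          omega
        · intro h0
          rcases eq_or_ne (a₁ T) 0 with h1 | h1
          · rw [h1, zero_add] at h0
            have := h₂c T h0
            omega
          · have := h₁c T h1
            omega
      · rw [sum_powerset_range_succ]
        have e1 : ∀ S ∈ powerset (range m), m ∉ S := fun S hS =>
          notMem_of_subset_range (mem_powerset.1 hS)
        rcases mem_powersetCard_range_succ hA with hA | ⟨A', hA', rfl⟩
        · have hAm := (mem_powersetCard.1 hA).1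
          have h := h₂ A hA
          have e2 : ∀ S, weight q (insert m S) A = 0 := fun S => weight_insert_left hAm
          simp only [e2, mul_zero, sum_const_zero, add_zero]
          rw [sub_eq_iff_eq_add, ← sum_add_distrib] at h
          rw [h]
          refine sum_congr rfl fun S hS => ?_
          rw [if_neg (e1 S hS)]
          ring
        · obtain ⟨hAm, hc⟩ := mem_powersetCard.1 hA'
          rw [h₁ A' hA', ← sum_add_distrib]
          refine sum_congr rfl fun S hS => ?_
          have hSm := mem_powerset.1 hS
          dsimp only
          rw [if_neg (e1 S hS), if_pos (mem_insert_self _ _), weight_insert_right hSm,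
            weight_insert_insert hSm hAm, erase_insert (e1 S hS), hc, inv_pow]
          field_simp
          ring

/-- The denominators are chosen so that lifting from the layer of `U` to layer `t` and then
evaluating on a `k`-set returns `a U`. Evaluating on a larger set instead leaves the ratio of
binomials on which the divisibility condition acts. -/
theorem sum_div_qBinom_mul_weight {k t : ℕ} {a : Finset ℕ → ℝ} {P : Finset (Finset ℕ)}
    {A C : Finset ℕ} (hAC : A ⊆ C) (hP : ∀ U ∈ P, #U ≤ t ∨ a U = 0) :
    ∑ B ∈ powersetCard t C, (∑ U ∈ P, a U / qBinom q (k - #U) (t - #U) * weight q U B)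
        * weight q B A
      = ∑ U ∈ P, a U * (qBinom q (#A - #U) (t - #U) / qBinom q (k - #U) (t - #U))
          * weight q U A := by
  simp only [sum_mul]
  rw [sum_comm]
  refine sum_congr rfl fun U hU => ?_
  rcases hP U hU with h | h
  · simp only [mul_assoc]
    rw [← mul_sum, sum_weight_mul_weight h hAC]
    ring
  · simp [h]

theorem sum_div_qBinom_mul_weight_of_card_eq {k t : ℕ} (htk : t ≤ k) {a : Finset ℕ → ℝ}
    {P : Finset (Finset ℕ)} {A C : Finset ℕ} (hAC : A ⊆ C) (hA : #A = k)
    (hP : ∀ U ∈ P, #U ≤ t ∨ a U = 0) :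
    ∑ B ∈ powersetCard t C, (∑ U ∈ P, a U / qBinom q (k - #U) (t - #U) * weight q U B)
        * weight q B A = ∑ U ∈ P, a U * weight q U A := by
  rw [sum_div_qBinom_mul_weight hAC hP, hA]
  refine sum_congr rfl fun U hU => ?_
  rcases hP U hU with h | h
  · rw [div_self, mul_one]
    exact_mod_cast (qBinom_pos (by omega)).ne'
  · simp [h]

/-- In a ground set of size `k + t` the weight matrix is square, so injectivity follows from
surjectivity, which `exists_eq_sum_weight` provides because its sets have size at most `t`. -/
theorem eq_zero_of_sum_weight_eq_zero (hq : 0 < q) {k t : ℕ} (htk : t ≤ k) (d : Finset ℕ → ℝ)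
    (hd : ∀ A ∈ powersetCard k (range (k + t)),
      ∑ B ∈ powersetCard t (range (k + t)), d B * weight q B A = 0) :
    ∀ B ∈ powersetCard t (range (k + t)), d B = 0 := by
  let W : (powersetCard t (range (k + t)) → ℝ) →ₗ[ℝ] (powersetCard k (range (k + t)) → ℝ) :=
    { toFun := fun d A => ∑ B, d B * weight q B A
      map_add' := fun d d' => by
        ext A; simp [add_mul, sum_add_distrib]
      map_smul' := fun r d => by
        ext A; simp [mul_assoc, mul_sum] }
  have hfin : Module.finrank ℝ (powersetCard t (range (k + t)) → ℝ)
      = Module.finrank ℝ (powersetCard k (range (k + t)) → ℝ) := by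
    simp [Nat.choose_symm_add (a := k) (b := t)]
  have hsurj : Function.Surjective W := by
    intro φ
    obtain ⟨a, -, hc, ha⟩ := exists_eq_sum_weight (R := ⊤) hq (by simp) (show k ≤ k + t by omega)
      (fun A => if h : A ∈ powersetCard k (range (k + t)) then φ ⟨A, h⟩ else 0) (by simp)
    refine ⟨fun B => ∑ S ∈ powerset (range (k + t)),
      a S / qBinom q (k - #S) (t - #S) * weight q S B, ?_⟩
    ext ⟨A, hA⟩
    obtain ⟨hAm, hAc⟩ := mem_powersetCard.1 hA
    have h := ha A hA
    rw [dif_pos hA] at h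
    rw [h]
    change ∑ B : powersetCard t (range (k + t)), (∑ S ∈ powerset (range (k + t)),
      a S / qBinom q (k - #S) (t - #S) * weight q S B) * weight q B A = _
    rw [sum_coe_sort (powersetCard t (range (k + t))) (fun B => (∑ S ∈ powerset (range (k + t)),
      a S / qBinom q (k - #S) (t - #S) * weight q S B) * weight q B A)]
    exact sum_div_qBinom_mul_weight_of_card_eq htk hAm hAc fun S _ =>
      (eq_or_ne (a S) 0).symm.imp_left fun h0 => by have := hc S h0; omega
  have hinj := (LinearMap.injective_iff_surjective_of_finrank_eq_finrank hfin).2 hsurj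
  intro B hB
  have h0 : W (fun B => d B) = 0 := by
    ext ⟨A, hA⟩
    change ∑ B : powersetCard t (range (k + t)), d B * weight q B A = 0
    rw [sum_coe_sort (powersetCard t (range (k + t))) (fun B => d B * weight q B A)]
    exact hd A hA
  have := hinj (h0.trans W.map_zero.symm)
  exact congrFun this ⟨B, hB⟩

/-- If the sums of `c` over the `t`-subsets of each `k`-set are integral, then `c` comes from
integral coefficients on the sets of size at most `t`. -/
theorem exists_coeff_of_sum_weight_mem (hq : 0 < q) (hR : (q : ℝ)⁻¹ ∈ R) {m k t : ℕ} (htk : t ≤ k)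
    (hm : k + t ≤ m) (c : Finset ℕ → ℝ)
    (hc : ∀ A ∈ powersetCard k (range m), ∑ B ∈ powersetCard t (range m), c B * weight q B A ∈ R) :
    ∃ a : Finset ℕ → ℝ, (∀ U, a U ∈ R) ∧ (∀ U, #U ≤ t ∨ a U = 0) ∧
      ∀ B ∈ powersetCard t (range m), c B
        = ∑ U ∈ powerset (range m), a U / qBinom q (k - #U) (t - #U) * weight q U B := by
  have hq0 : (q : ℝ) ≠ 0 := by exact_mod_cast hq.ne'
  induction m generalizing k t c with
  | zero =>
    obtain rfl : k = 0 := by omega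
    obtain rfl : t = 0 := by omega
    refine ⟨fun U => if U = ∅ then c ∅ else 0, fun U => ?_, fun U => ?_, fun B hB => ?_⟩
    · dsimp only
      split_ifs
      · simpa using hc ∅ (by simp)
      · exact R.zero_mem
    · dsimp only
      split_ifs with h
      · simp [h]
      · exact Or.inr rfl
    · simp at hB
      simp [hB, qBinom_zero_right]
  | succ m ih =>
    cases t with
    | zero =>
      refine ⟨fun U => if U = ∅ then c ∅ else 0, fun U => ?_, fun U => ?_, fun B hB => ?_⟩
      · dsimp only
        split_ifs
        · obtain ⟨A, hA⟩ := powersetCard_nonempty.2 (show k ≤ #(range (m + 1)) by simpa using hm)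
          simpa using hc A hA
        · exact R.zero_mem
      · dsimp only
        split_ifs with h
        · simp [h]
        · exact Or.inr rfl
      · rw [powersetCard_zero, mem_singleton] at hB
        rw [sum_eq_single ∅ (fun S _ hS => by simp [hS]) (fun h => by simp at h), hB]
        simp [qBinom_zero_right]
    | succ t =>
      -- In the square case the coefficients of `exists_eq_sum_weight` reproduce the sums on the
      -- `k`-sets, and injectivity identifies the resulting function with `c`.
      rcases hm.eq_or_lt with hm' | hm'
      · rw [← hm'] at hc ⊢
        obtain ⟨a, haR, hac, ha⟩ := exists_eq_sum_weight hq hR (show k ≤ k + (t + 1) by omega)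
          _ hc
        have hac' : ∀ U, #U ≤ t + 1 ∨ a U = 0 := fun U =>
          (eq_or_ne (a U) 0).symm.imp_left fun h0 => by have := hac U h0; omega
        refine ⟨a, haR, hac', fun B hB => ?_⟩
        rw [← sub_eq_zero]
        refine eq_zero_of_sum_weight_eq_zero hq htk (fun B => c B - ∑ U ∈ powerset
          (range (k + (t + 1))), a U / qBinom q (k - #U) (t + 1 - #U) * weight q U B)
          (fun A hA => ?_) B hB
        obtain ⟨hAm, hAc⟩ := mem_powersetCard.1 hA
        simp only [sub_mul, sum_sub_distrib]
        rw [sum_div_qBinom_mul_weight_of_card_eq htk hAm hAc fun U _ => hac' U, ha A hA, sub_self]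
      · obtain ⟨k, rfl⟩ : ∃ k', k = k' + 1 := ⟨k - 1, by omega⟩
        obtain ⟨a₀, h₀R, h₀c, h₀⟩ := ih htk (by omega) c fun A hA => by
          have := hc A (mem_powersetCard_range_of_le hA)
          rw [sum_powersetCard_range_succ] at this
          simpa only [weight_insert_left (mem_powersetCard.1 hA).1, mul_zero, sum_const_zero,
            add_zero] using this
        -- `c₀` agrees with `c` on the sets avoiding `m`. The difference lives on the sets
        -- containing `m`; deleting `m` lowers both `k` and `t` by one.
        set c₀ : Finset ℕ → ℝ := fun B => ∑ U ∈ powerset (range m),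
          a₀ U / qBinom q (k + 1 - #U) (t + 1 - #U) * weight q U B with hc₀
        obtain ⟨a₁, h₁R, h₁c, h₁⟩ := ih (k := k) (t := t) (by omega) (by omega)
          (fun B => c (insert m B) - c₀ (insert m B)) fun A hA => by
            obtain ⟨hAm, hAc⟩ := mem_powersetCard.1 hA
            have hA' := insert_mem_powersetCard_range hA
            obtain ⟨hAm', hAc'⟩ := mem_powersetCard.1 hA'
            have h := R.sub_mem (hc _ hA') (R.sum_mem (t := powerset (range m)) fun U _ =>
              R.mul_mem (h₀R U) (weight_mem (q := q) U (insert m A)))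
            rw [← sum_div_qBinom_mul_weight_of_card_eq htk hAm' hAc' fun U _ => h₀c U,
              ← sum_sub_distrib, sum_powersetCard_range_succ, sum_eq_zero, zero_add] at h
            -- Deleting `m` from both sets divides every weight by `q ^ (k - t)`, a unit of `R`.
            · have h' := R.mul_mem h (R.pow_mem hR (k - t))
              rw [sum_mul] at h'
              convert h' using 2 with B hB
              obtain ⟨hBm, hBc⟩ := mem_powersetCard.1 hB
              rw [weight_insert_insert hBm hAm, hAc, hBc, inv_pow, ← sub_mul]
              change _ = (c (insert m B) - c₀ (insert m B)) * _ * _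
              clear_value c₀
              field_simp
            · intro B hB
              rw [h₀ B hB, sub_self]
        -- The power of `q` compensates for `weight_insert_insert` with `#B' = t`. Since `k` and `t`
        -- both dropped by one while `#(insert m S) = #S + 1`, the binomial denominators match.
        refine ⟨fun T => if m ∈ T then a₁ (T.erase m) * (q : ℝ)⁻¹ ^ (t - #(T.erase m))
          else a₀ T, fun T => ?_, fun T => ?_, fun B hB => ?_⟩
        · dsimp only
          split_ifs
          · exact R.mul_mem (h₁R _) (R.pow_mem hR _)
          · exact h₀R _
        · dsimp only
          split_ifs with h
          · rcases h₁c (T.erase m) with h' | h'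
            · left
              rw [card_erase_of_mem h] at h'
              omega
            · right; rw [h', zero_mul]
          · exact h₀c T
        · rw [sum_powerset_range_succ]
          have e1 : ∀ S ∈ powerset (range m), m ∉ S := fun S hS =>
            notMem_of_subset_range (mem_powerset.1 hS)
          have e3 : ∀ S ∈ powerset (range m), #(insert m S) = #S + 1 := fun S hS =>
            card_insert_of_notMem (e1 S hS)
          have e4 : ∀ B, ∑ S ∈ powerset (range m), (if m ∈ S then a₁ (S.erase m) *
              (q : ℝ)⁻¹ ^ (t - #(S.erase m)) else a₀ S) /
              qBinom q (k + 1 - #S) (t + 1 - #S) * weight q S B = c₀ B := fun B =>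
            sum_congr rfl fun S hS => by rw [if_neg (e1 S hS)]
          rw [e4]
          rcases mem_powersetCard_range_succ hB with hB | ⟨B', hB', rfl⟩
          · have hBm := (mem_powersetCard.1 hB).1
            simp only [weight_insert_left hBm, mul_zero, sum_const_zero, add_zero]
            exact h₀ B hB
          · obtain ⟨hBm, hBc⟩ := mem_powersetCard.1 hB'
            rw [← sub_eq_iff_eq_add', h₁ B' hB']
            refine sum_congr rfl fun S hS => ?_
            have hSm := mem_powerset.1 hS
            dsimp only
            rw [if_pos (mem_insert_self _ _), e3 S hS, weight_insert_insert hSm hBm,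
              erase_insert (e1 S hS), hBc, inv_pow, Nat.add_sub_add_right, Nat.add_sub_add_right]
            field_simp

/-- Under the divisibility condition, a function with integral sums over the `t`-subsets of each
`k`-set has an integral total sum. -/
theorem sum_weight_mem (hq : 0 < q) (hR : (q : ℝ)⁻¹ ∈ R) {n k t : ℕ} (htk : t ≤ k)
    (hn : k + t ≤ n) (hdiv : ∀ i < t, k - i ∣ n - i) (c : Finset ℕ → ℝ)
    (hc : ∀ A ∈ powersetCard k (range n), ∑ B ∈ powersetCard t (range n), c B * weight q B A ∈ R) :
    ∑ B ∈ powersetCard t (range n), c B * weight q B (range n) ∈ R := by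
  obtain ⟨a, haR, hac, ha⟩ := exists_coeff_of_sum_weight_mem hq hR htk hn c hc
  rw [sum_congr rfl fun B hB => by rw [ha B hB],
    sum_div_qBinom_mul_weight subset_rfl fun U _ => hac U, card_range]
  refine R.sum_mem fun U _ => R.mul_mem ?_ (weight_mem _ _)
  rcases hac U with h | h
  · obtain ⟨d, hd⟩ := qBinom_sub_dvd_qBinom_sub (q := q) (n := n) (k := k) (i := #U) (t := t)
      fun j _ hj => hdiv j hj
    have h0 : (qBinom q (k - #U) (t - #U) : ℝ) ≠ 0 := by
      exact_mod_cast (qBinom_pos (by omega)).ne'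
    rw [hd, Nat.cast_mul, mul_div_cancel_left₀ _ h0]
    exact R.mul_mem (haR U) (natCast_mem R d)
  · rw [h, zero_mul]
    exact R.zero_mem

end Weights

/-! ### From posets with a pivot map to the weighted Boolean lattice. -/

theorem sum_powersetCard_ite_subset {C U : Finset ℕ} {t : ℕ} (hUt : #U ≤ t) (hUC : U ⊆ C)
    (f : Finset ℕ → ℕ) :
    ∑ T ∈ powersetCard t C, (if U ⊆ T then f (T \ U) else 0)
      = ∑ X ∈ powersetCard (t - #U) (C \ U), f X := by
  have e : ∀ Z ⊆ C \ U, (U ∪ Z) \ U = Z := fun Z hZ => by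
    rw [union_sdiff_left, sdiff_eq_self_of_disjoint]
    exact (disjoint_sdiff.mono_right hZ).symm
  symm
  refine sum_of_injOn (fun X => U ∪ X) ?_ ?_ ?_ ?_
  · intro X hX Y hY h
    rw [← e X (mem_powersetCard.1 hX).1, ← e Y (mem_powersetCard.1 hY).1]
    exact congrArg (· \ U) h
  · intro X hX
    obtain ⟨hX, hc⟩ := mem_powersetCard.1 hX
    refine mem_powersetCard.2 ⟨union_subset hUC (hX.trans sdiff_subset), ?_⟩
    rw [card_union_of_disjoint (disjoint_sdiff.mono_right hX), hc]
    omega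
  · intro T hT hT'
    refine if_neg fun h => hT' ⟨T \ U, ?_, union_sdiff_of_subset h⟩
    obtain ⟨hTC, hc⟩ := mem_powersetCard.1 hT
    refine mem_powersetCard.2 ⟨sdiff_subset_sdiff hTC subset_rfl, ?_⟩
    rw [card_sdiff_of_subset h, hc]
  · intro X hX
    rw [if_pos subset_union_left, e X (mem_powersetCard.1 hX).1]

open Classical in
theorem card_layer_filter {L : Type*} [Fintype L] (rk : L → ℕ) (k : ℕ) (P : L → Prop) :
    #{K : Layer rk k | P K.1} = #{K : L | rk K = k ∧ P K} := by
  refine card_bij (fun K _ => K.1) ?_ ?_ ?_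
  · intro K hK
    simpa [K.2] using hK
  · intro K _ K' _ h
    exact Subtype.ext h
  · intro K hK
    simp only [mem_filter, mem_univ, true_and] at hK
    exact ⟨⟨K, hK.1⟩, by simpa using hK.2, rfl⟩

theorem mem_rowSpace_iff {L : Type*} [PartialOrder L] {rk : L → ℕ} {k t : ℕ} {f : Layer rk k → ℝ}
    [Fintype (Layer rk t)] :
    f ∈ rowSpace rk k t ↔ ∃ c : Layer rk t → ℝ, ∀ K, f K = ∑ T, c T * incMatrix rk t k T K := by
  rw [rowSpace, Submodule.mem_span_range_iff_exists_fun]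
  refine exists_congr fun c => ?_
  rw [funext_iff]
  refine forall_congr' fun K => ?_
  simp only [Finset.sum_apply, Pi.smul_apply, smul_eq_mul]
  exact eq_comm

open Classical in
/-- A map `J` which behaves like the map from subspaces to their sets of pivots, that is, to the
Schubert cells with respect to a flag in an `n`-dimensional space over a field of order `q`. -/
structure IsPivotMap {L : Type*} [PartialOrder L] [Fintype L] (rk : L → ℕ) (n q : ℕ)
    (J : L → Finset ℕ) : Prop where
  subset_range (U : L) : J U ⊆ range n
  card_eq (U : L) : #(J U) = rk U
  card_filter (T : L) {A : Finset ℕ} (hA : A ⊆ range n) :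
    #{K | T ≤ K ∧ J K = A}
      = if J T ⊆ A then q ^ inversions (A \ J T) (range n \ A) else 0

namespace IsPivotMap

variable {L : Type*} [PartialOrder L] [Fintype L] {rk : L → ℕ} {n q : ℕ} {J : L → Finset ℕ}

/-- Otherwise `card_filter` would leave no element above `T` in the cell of `K`. -/
theorem mono (hJ : IsPivotMap rk n q J) {T K : L} (h : T ≤ K) : J T ⊆ J K := by
  classical
  by_contra h'
  have h0 := hJ.card_filter T (hJ.subset_range K)
  rw [if_neg h', card_eq_zero] at h0
  exact notMem_empty K (h0 ▸ by simp [h])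

/-- `K` has the pivot set of `T`, and the only element above `T` in its own cell is `T`, as the
count there is `q ^ 0`. -/
theorem eq_of_le (hJ : IsPivotMap rk n q J) {T K : L} (h : T ≤ K) (hr : rk K = rk T) : T = K := by
  classical
  have hTK : J K = J T :=
    (eq_of_subset_of_card_le (hJ.mono h) (by rw [hJ.card_eq, hJ.card_eq, hr])).symm
  have h0 := hJ.card_filter T (hJ.subset_range T)
  rw [if_pos subset_rfl, sdiff_self, bot_eq_empty, inversions_empty_left, pow_zero] at h0
  exact card_le_one.1 h0.le T (by simp) K (by simp [h, hTK])

theorem exists_eq (hJ : IsPivotMap rk n q J) (hq : 0 < q) [OrderBot L] (hbot : rk ⊥ = 0)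
    {A : Finset ℕ} (hA : A ⊆ range n) : ∃ K, J K = A := by
  classical
  have hb : J ⊥ = ∅ := card_eq_zero.1 (by rw [hJ.card_eq, hbot])
  have h := hJ.card_filter ⊥ hA
  rw [hb, if_pos (empty_subset _)] at h
  have : 0 < #{K | ⊥ ≤ K ∧ J K = A} := by rw [h]; positivity
  obtain ⟨K, hK⟩ := card_pos.1 this
  exact ⟨K, (mem_filter.1 hK).2.2⟩

open Classical in
theorem card_layer_cell (hJ : IsPivotMap rk n q J) (T : L) {A : Finset ℕ} {k : ℕ}
    (hA : A ∈ powersetCard k (range n)) :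
    #{K : Layer rk k | T ≤ K.1 ∧ J K.1 = A}
      = if J T ⊆ A then q ^ inversions (A \ J T) (range n \ A) else 0 := by
  obtain ⟨hA, hc⟩ := mem_powersetCard.1 hA
  rw [← hJ.card_filter T hA]
  refine Eq.trans (by convert card_layer_filter rk k (fun K => T ≤ K ∧ J K = A)) (congrArg card ?_)
  ext K
  simp only [mem_filter, mem_univ, true_and, and_iff_right_iff_imp]
  rintro ⟨-, h⟩
  rw [← hJ.card_eq, h, hc]

open Classical in
/-- The number of elements of rank `k` above a given element. -/
theorem card_layer_ge (hJ : IsPivotMap rk n q J) (T : L) {k : ℕ} (hk : rk T ≤ k) :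
    #{K : Layer rk k | T ≤ K.1} = qBinom q (n - rk T) (k - rk T) := by
  rw [card_eq_sum_card_fiberwise (f := fun K => J K.1) (t := powersetCard k (range n))
    fun K _ => mem_powersetCard.2 ⟨hJ.subset_range _, by rw [hJ.card_eq, K.2]⟩]
  have hT : #(range n \ J T) = n - rk T := by
    rw [card_sdiff_of_subset (hJ.subset_range T), card_range, hJ.card_eq]
  rw [← hJ.card_eq] at hk
  rw [← hT, ← sum_pow_inversions, ← hJ.card_eq,
    ← sum_powersetCard_ite_subset hk (hJ.subset_range T)]
  refine sum_congr rfl fun A hA => ?_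
  rw [filter_filter, hJ.card_layer_cell T hA]
  split_ifs with h
  · congr 2
    ext x
    simp only [mem_sdiff]
    have := @h x
    tauto
  · rfl

open Classical in
/-- If the divisibility condition holds and a function of degree `t` has integral values, then the
sum of its coefficients is integral. -/
theorem sum_coeff_mem (hJ : IsPivotMap rk n q J) (hq : 0 < q) {R : Subring ℝ}
    (hR : (q : ℝ)⁻¹ ∈ R) {k t : ℕ} (htk : t ≤ k) (hn : k + t ≤ n)
    (hdiv : ∀ i < t, k - i ∣ n - i) (c : Layer rk t → ℝ)
    (hc : ∀ K : Layer rk k, ∑ T : Layer rk t, c T * (if T.1 ≤ K.1 then 1 else 0) ∈ R) :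
    ∑ T, c T ∈ R := by
  have hq0 : (q : ℝ) ≠ 0 := by exact_mod_cast hq.ne'
  have hmaps : ∀ T ∈ (univ : Finset (Layer rk t)), J T.1 ∈ powersetCard t (range n) :=
    fun T _ => mem_powersetCard.2 ⟨hJ.subset_range _, by rw [hJ.card_eq, T.2]⟩
  have key := sum_weight_mem (q := q) hq hR htk hn hdiv
    -- Normalised so that multiplying by the weight of `B` in `range n` returns the plain sum of `c`
    -- over the cell of `B`.
    (fun B => (q : ℝ)⁻¹ ^ inversions B (range n \ B) * ∑ T : Layer rk t with J T.1 = B, c T) ?_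
  · rw [← sum_fiberwise_of_maps_to hmaps]
    convert key using 2 with B hB
    have hB := (mem_powersetCard.1 hB).1
    rw [weight_of_subset hB, inv_pow]
    field_simp
  · intro A hA
    have hAn := (mem_powersetCard.1 hA).1
    -- With this scaling of the cell of `A`, both sides carry the same power, with exponent
    -- `-inversions B (range n \ A)`, for each `B ⊆ A`.
    have h := R.mul_mem (R.pow_mem hR (inversions A (range n \ A)))
      (R.sum_mem (t := {K : Layer rk k | J K.1 = A}) fun K _ => hc K)
    convert h using 1
    have e1 : ∀ T : Layer rk t,
        ∑ K : Layer rk k with J K.1 = A, (if T.1 ≤ K.1 then (1 : ℝ) else 0)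
          = if J T.1 ⊆ A then (q : ℝ) ^ inversions (A \ J T.1) (range n \ A) else 0 := fun T => by
      rw [sum_boole, filter_filter]
      simp only [and_comm (a := J _ = A)]
      rw [hJ.card_layer_cell T.1 hA]
      push_cast
      rfl
    rw [sum_comm]
    simp only [← mul_sum, e1]
    rw [← sum_fiberwise_of_maps_to hmaps, mul_sum]
    refine sum_congr rfl fun B hB => ?_
    rw [mul_sum, mul_sum, sum_mul]
    refine sum_congr rfl fun T hT => ?_
    rw [(mem_filter.1 hT).2]
    by_cases hBA : B ⊆ A
    · rw [if_pos hBA, weight_of_subset hBA]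
      have i1 : inversions B (range n \ B)
          = inversions B (A \ B) + inversions B (range n \ A) := by
        rw [← inversions_union_right]
        · congr 1
          ext x
          simp only [mem_sdiff, mem_union]
          have := @hBA x
          have := @hAn x
          tauto
        · exact disjoint_sdiff.mono_left sdiff_subset
      have i2 : inversions A (range n \ A)
          = inversions B (range n \ A) + inversions (A \ B) (range n \ A) := by
        rw [← inversions_union_left _ disjoint_sdiff, union_sdiff_of_subset hBA]
      rw [i1, i2, inv_pow, inv_pow, pow_add, pow_add]
      field_simp
    · rw [if_neg hBA, weight_of_not_subset hBA]
      ring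

theorem mem_rowSpace_self (hJ : IsPivotMap rk n q J) {k : ℕ} (f : Layer rk k → ℝ) :
    f ∈ rowSpace rk k k := by
  classical
  refine mem_rowSpace_iff.2 ⟨f, fun K => ?_⟩
  rw [sum_eq_single K]
  · simp [incMatrix]
  · intro T _ hT
    have : ¬ T ≤ K := fun h =>
      hT (Subtype.ext (hJ.eq_of_le h (by rw [T.2, K.2])))
    simp [incMatrix, this]
  · simp

/-- The size of a set of degree `t` is divisible by the size of a `t`-pencil. -/
theorem qBinom_dvd_ncard_of_mem_rowSpace (hJ : IsPivotMap rk n q J) (hq : 0 < q) {k t : ℕ}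
    (htk : t ≤ k) (hn : k + t ≤ n) (hdiv : ∀ i < t, k - i ∣ n - i) {𝓕 : Set (Layer rk k)}
    (h𝓕 : 𝓕.indicator 1 ∈ rowSpace rk k t) :
    qBinom q (n - t) (k - t) ∣ 𝓕.ncard := by
  classical
  obtain ⟨c, hc⟩ := mem_rowSpace_iff.1 h𝓕
  -- This is `ℤ[1/q]`.
  let R : Subring ℝ :=
    { carrier := {x | ∃ (N : ℕ) (z : ℤ), (q : ℝ) ^ N * x = z}
      mul_mem' := by
        rintro x y ⟨N, z, h⟩ ⟨N', z', h'⟩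
        refine ⟨N + N', z * z', ?_⟩
        push_cast
        rw [← h, ← h']; ring
      one_mem' := ⟨0, 1, by simp⟩
      add_mem' := by
        rintro x y ⟨N, z, h⟩ ⟨N', z', h'⟩
        refine ⟨N + N', q ^ N' * z + q ^ N * z', ?_⟩
        push_cast
        rw [← h, ← h']; ring
      zero_mem' := ⟨0, 0, by simp⟩
      neg_mem' := by
        rintro x ⟨N, z, h⟩
        exact ⟨N, -z, by push_cast; rw [← h]; ring⟩ }
  have hR : (q : ℝ)⁻¹ ∈ R := ⟨1, 1, by
    have : (q : ℝ) ≠ 0 := by exact_mod_cast hq.ne'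
    simp [this]⟩
  obtain ⟨N, z, hz⟩ : ∑ T, c T ∈ R := hJ.sum_coeff_mem hq hR htk hn hdiv c fun K => by
    have := hc K
    simp only [incMatrix, Matrix.of_apply] at this
    rw [← this, Set.indicator_apply]
    split_ifs
    · exact R.one_mem
    · exact R.zero_mem
  have h1 : (𝓕.ncard : ℝ) = qBinom q (n - t) (k - t) * ∑ T, c T := by
    have e : (𝓕.ncard : ℝ) = ∑ K, 𝓕.indicator (1 : Layer rk k → ℝ) K := by
      rw [Set.ncard_eq_toFinset_card']
      simp [Set.indicator_apply]
    rw [e, sum_congr rfl fun K _ => hc K, sum_comm, mul_sum]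
    refine sum_congr rfl fun T _ => ?_
    rw [← mul_sum, mul_comm]
    congr 1
    simp only [incMatrix, Matrix.of_apply]
    rw [sum_boole, hJ.card_layer_ge T.1 (by rw [T.2]; exact htk), T.2]
  have h2 : ((q : ℤ) ^ N * 𝓕.ncard) = qBinom q (n - t) (k - t) * z := by
    have : ((q : ℝ) ^ N * 𝓕.ncard) = qBinom q (n - t) (k - t) * z := by
      rw [h1, ← hz]; ring
    exact_mod_cast this
  have h3 : qBinom q (n - t) (k - t) ∣ q ^ N * 𝓕.ncard := by
    have := Dvd.intro _ h2.symm
    exact_mod_cast this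
  exact ((coprime_qBinom (by omega)).symm.pow_right N).dvd_of_dvd_mul_left h3

variable [OrderTop L]

theorem qBinom_dvd_ncard (hJ : IsPivotMap rk n q J) (hq : 0 < q) (htop : rk ⊤ = n) {k t : ℕ}
    (htk : t ≤ k) (hkn : 2 * k ≤ n) (hdiv : ∀ i < t, k - i ∣ n - i) {𝓕 : Set (Layer rk k)}
    (hne : 𝓕 ≠ ∅) (hdeg : setDegree rk k 𝓕 ≤ (t : WithBot ℕ)) :
    qBinom q (n - t) (k - t) ∣ 𝓕.ncard := by
  have h0 : 𝓕.indicator (1 : Layer rk k → ℝ) ≠ 0 := by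
    obtain ⟨K, hK⟩ := Set.nonempty_iff_ne_empty.2 hne
    exact fun h => by simpa [hK] using congrFun h K
  rw [setDegree, degree, if_neg h0, htop, Nat.cast_le] at hdeg
  -- The infimum of an empty set of naturals would be `0`, so a witness is needed: `k` itself,
  -- admissible because `2 * k ≤ n`.
  have hmem := Nat.sInf_mem (s := {t : ℕ | t ≤ min k (n - k) ∧
    𝓕.indicator (1 : Layer rk k → ℝ) ∈ rowSpace rk k t})
    ⟨k, le_min le_rfl (by omega), hJ.mem_rowSpace_self _⟩
  set s := sInf {t : ℕ | t ≤ min k (n - k) ∧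
    𝓕.indicator (1 : Layer rk k → ℝ) ∈ rowSpace rk k t}
  exact (qBinom_dvd_qBinom_sub hdeg htk (by omega) fun j _ hj => hdiv j hj).trans
    (hJ.qBinom_dvd_ncard_of_mem_rowSpace hq (by omega) (by omega)
      (fun i hi => hdiv i (by omega)) hmem.2)

/-- The set of elements of rank `k` above an element of rank `t` has degree at most `t`. -/
theorem setDegree_pencil_le {k t : ℕ} (htk : t ≤ k) (hkn : k + t ≤ rk ⊤) (T : Layer rk t) :
    setDegree rk k {K | T.1 ≤ K.1} ≤ (t : WithBot ℕ) := by
  classical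
  rw [setDegree, degree]
  split_ifs
  · exact bot_le
  · refine Nat.cast_le.2 (Nat.sInf_le ⟨le_min htk (by omega), Submodule.subset_span ⟨T, ?_⟩⟩)
    ext K
    simp [incMatrix, Set.indicator_apply]

theorem isLeast_sizes [OrderBot L] (hJ : IsPivotMap rk n q J) (hq : 0 < q) (htop : rk ⊤ = n)
    (hbot : rk ⊥ = 0) {k t : ℕ} (htk : t ≤ k) (hkn : 2 * k ≤ n) (hdiv : ∀ i < t, k - i ∣ n - i) :
    IsLeast (nonemptySizes rk k t) (qBinom q (n - t) (k - t)) ∧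
      (1 ≤ t → IsLeast (properSizes rk k t) (qBinom q (n - t) (k - t))) := by
  classical
  have lower : ∀ 𝓕 : Set (Layer rk k), 𝓕 ≠ ∅ → setDegree rk k 𝓕 ≤ (t : WithBot ℕ) →
      qBinom q (n - t) (k - t) ≤ 𝓕.ncard := fun 𝓕 hne hdeg =>
    Nat.le_of_dvd ((Set.ncard_pos 𝓕.toFinite).2 (Set.nonempty_iff_ne_empty.2 hne))
      (hJ.qBinom_dvd_ncard hq htop htk hkn hdiv hne hdeg)
  obtain ⟨S, hS⟩ := hJ.exists_eq hq hbot (A := range t) (range_mono (by omega))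
  have hSt : rk S = t := by rw [← hJ.card_eq, hS, card_range]
  have hcard : ({K | S ≤ K.1} : Set (Layer rk k)).ncard = qBinom q (n - t) (k - t) := by
    rw [Set.ncard_eq_toFinset_card', Set.toFinset_ofPred, hJ.card_layer_ge S (hSt.trans_le htk), hSt]
  have hne : ({K | S ≤ K.1} : Set (Layer rk k)) ≠ ∅ := by
    intro h
    rw [h, Set.ncard_empty] at hcard
    exact (qBinom_pos (q := q) (n := n - t) (k := k - t) (by omega)).ne hcard
  have hdeg : setDegree rk k {K | S ≤ K.1} ≤ (t : WithBot ℕ) :=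
    setDegree_pencil_le htk (by omega) ⟨S, hSt⟩
  refine ⟨⟨⟨_, hne, hdeg, hcard⟩, ?_⟩, fun ht => ⟨⟨_, hne, fun h => ?_, hdeg, hcard⟩, ?_⟩⟩
  · rintro _ ⟨𝓕, h, h', rfl⟩
    exact lower 𝓕 h h'
  -- The pencil is proper: an element of rank `k` whose pivots avoid `0` is not above `S`, whose
  -- pivot set `range t` contains `0`.
  · obtain ⟨A, hA, hAc⟩ := exists_subset_card_eq (s := (range n).erase 0) (n := k)
      (by rw [card_erase_of_mem (mem_range.2 (by omega)), card_range]; omega)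
    obtain ⟨K, hK⟩ := hJ.exists_eq hq hbot (hA.trans (erase_subset _ _))
    have hSK : S ≤ K :=
      Set.eq_univ_iff_forall.1 h (⟨K, by rw [← hJ.card_eq, hK, hAc]⟩ : Layer rk k)
    have := hJ.mono hSK
    rw [hS, hK] at this
    exact notMem_erase 0 _ (hA (this (mem_range.2 ht)))
  · rintro _ ⟨𝓕, h, -, h', rfl⟩
    exact lower 𝓕 h h'

end IsPivotMap

/-! ### The pivot map for sets. -/

theorem isPivotMap_setRank {V : Type*} [Fintype V] {n : ℕ} (e : V ≃ Fin n) :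
    IsPivotMap (setRank V) n 1 fun U => U.map (e.toEmbedding.trans Fin.valEmbedding) where
  subset_range U x hx := by
    obtain ⟨v, -, rfl⟩ := mem_map.1 hx
    simp
  card_eq U := card_map _
  card_filter T A hA := by
    classical
    rw [one_pow]
    obtain ⟨K₀, rfl⟩ : ∃ K : Finset V, K.map (e.toEmbedding.trans Fin.valEmbedding) = A := by
      refine ⟨univ.filter fun v => (e v : ℕ) ∈ A, ?_⟩
      ext x
      simp only [mem_map, mem_filter, mem_univ, true_and]
      constructor
      · rintro ⟨v, hv, rfl⟩
        exact hv
      · intro hx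
        exact ⟨e.symm ⟨x, mem_range.1 (hA hx)⟩, by simpa using hx, by simp⟩
    simp only [map_inj, map_subset_map]
    split_ifs with h
    · rw [card_eq_one]
      refine ⟨K₀, ?_⟩
      ext K
      simp only [mem_filter, mem_univ, true_and, mem_singleton, and_iff_right_iff_imp]
      rintro rfl
      exact h
    · rw [card_eq_zero, filter_eq_empty_iff]
      rintro K - ⟨hK, rfl⟩
      exact h hK

/-! ### Counting subspaces relative to a hyperplane. -/

section Subspaces

variable {F V : Type*} [Field F] [AddCommGroup V] [Module F V]

theorem sup_span_inf_eq {H K : Submodule F V} {x : V} (hKH : K ≤ H) (hx : x ∉ H) :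
    (K ⊔ Submodule.span F {x}) ⊓ H = K := by
  rw [sup_inf_assoc_of_le _ hKH, sup_eq_left]
  rintro y ⟨hy, hyH⟩
  obtain ⟨a, rfl⟩ := Submodule.mem_span_singleton.1 hy
  rcases eq_or_ne a 0 with rfl | ha
  · simp
  · exact absurd ((Submodule.smul_mem_iff _ ha).1 hyH) hx

variable [FiniteDimensional F V]

theorem sup_eq_of_not_le {H E K : Submodule F V} (hHE : H ≤ E)
    (hfin : Module.finrank F E = Module.finrank F H + 1) (hKE : K ≤ E) (hKH : ¬ K ≤ H) :
    K ⊔ H = E := by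
  refine Submodule.eq_of_le_of_finrank_le (sup_le hKE hHE) ?_
  rw [hfin]
  exact Submodule.finrank_lt_finrank_of_lt (right_lt_sup.2 hKH)

theorem finrank_eq_finrank_inf_add_one {H E K : Submodule F V} (hHE : H ≤ E)
    (hfin : Module.finrank F E = Module.finrank F H + 1) (hKE : K ≤ E) (hKH : ¬ K ≤ H) :
    Module.finrank F K = Module.finrank F (K ⊓ H : Submodule F V) + 1 := by
  have h := Submodule.finrank_sup_add_finrank_inf_eq K H
  rw [sup_eq_of_not_le hHE hfin hKE hKH] at h
  omega

variable [Fintype (Submodule F V)]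

-- As `T ⊔ H = E`, the modular law makes `K ↦ K ⊓ H` and `K ↦ K ⊔ T` mutually inverse.
open Classical in
theorem card_filter_of_not_le {H E T : Submodule F V} (hHE : H ≤ E)
    (hfin : Module.finrank F E = Module.finrank F H + 1) (hTE : T ≤ E) (hTH : ¬ T ≤ H)
    (P : Submodule F V → Prop) :
    #{K : Submodule F V | T ≤ K ∧ K ≤ E ∧ P (K ⊓ H)}
      = #{K : Submodule F V | T ⊓ H ≤ K ∧ K ≤ H ∧ P K} := by
  have h1 : ∀ K, T ≤ K → K ≤ E → K ⊓ H ⊔ T = K := fun K hTK hKE => by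
    rw [inf_sup_assoc_of_le _ hTK, sup_comm H, sup_eq_of_not_le hHE hfin hTE hTH,
      inf_eq_left.2 hKE]
  have h2 : ∀ K, T ⊓ H ≤ K → K ≤ H → (K ⊔ T) ⊓ H = K := fun K hTK hKH => by
    rw [sup_inf_assoc_of_le _ hKH, sup_eq_left.2 hTK]
  refine card_nbij' (fun K => K ⊓ H) (fun K => K ⊔ T) ?_ ?_ ?_ ?_
  · intro K hK
    simp only [coe_filter, mem_univ, true_and, Set.mem_ofPred_eq] at hK ⊢
    exact ⟨inf_le_inf_right _ hK.1, inf_le_right, hK.2.2⟩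
  · intro K hK
    simp only [coe_filter, mem_univ, true_and, Set.mem_ofPred_eq] at hK ⊢
    exact ⟨le_sup_right, sup_le (hK.2.1.trans hHE) hTE, by rw [h2 K hK.1 hK.2.1]; exact hK.2.2⟩
  · intro K hK
    simp only [coe_filter, mem_univ, true_and, Set.mem_ofPred_eq] at hK
    exact h1 K hK.1 hK.2.1
  · intro K hK
    simp only [coe_filter, mem_univ, true_and, Set.mem_ofPred_eq] at hK
    exact h2 K hK.1 hK.2.1

variable [Fintype F]

open Classical in
/-- The number of subspaces of `E` which meet the hyperplane `H` of `E` in a given subspace. -/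
theorem card_inf_eq {H E K₀ : Submodule F V} (hHE : H ≤ E)
    (hfin : Module.finrank F E = Module.finrank F H + 1) (hK₀ : K₀ ≤ H) :
    #{K : Submodule F V | K ≤ E ∧ ¬ K ≤ H ∧ K ⊓ H = K₀}
      = Fintype.card F ^ (Module.finrank F H - Module.finrank F K₀) := by
  have : Finite V := Module.finite_of_finite F
  let _ : Fintype V := Fintype.ofFinite V
  have hcard : ∀ W : Submodule F V,
      #{x : V | x ∈ W} = Fintype.card F ^ Module.finrank F W := fun W => by
    rw [← Fintype.card_subtype, ← Nat.card_eq_fintype_card, ← Nat.card_eq_fintype_card]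
    exact Module.natCard_eq_pow_finrank
  have hdiff : ∀ W : Submodule F V, #{x : V | x ∈ W ∧ x ∉ H} = Fintype.card F ^ Module.finrank F W
      - Fintype.card F ^ Module.finrank F (W ⊓ H : Submodule F V) := fun W => by
    rw [← hcard, ← hcard, ← card_sdiff_of_subset fun x => by simp +contextual]
    · congr 1
      ext x
      simp only [mem_filter, mem_univ, true_and, mem_sdiff, Submodule.mem_inf]
      tauto
  -- Double counting of incident pairs: each vector `x` of `E` outside `H` lies in exactly one such
  -- subspace, namely `K₀ ⊔ span {x}`, and each such subspace has the same number of vectors outside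
  -- `H`.
  have key := card_mul_eq_card_mul (s := {x : V | x ∈ E ∧ x ∉ H})
    (t := {K : Submodule F V | K ≤ E ∧ ¬ K ≤ H ∧ K ⊓ H = K₀}) (m := 1)
    (n := Fintype.card F ^ (Module.finrank F K₀ + 1) - Fintype.card F ^ Module.finrank F K₀)
    (fun x K => x ∈ K) ?_ ?_
  · rw [hdiff, inf_eq_right.2 hHE, hfin, mul_one] at key
    have h2 : 2 ≤ Fintype.card F := Fintype.one_lt_card
    have hle := Submodule.finrank_mono hK₀
    obtain ⟨d, hd⟩ := Nat.exists_eq_add_of_le hle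
    have e : ∀ a, Fintype.card F ^ (a + 1) - Fintype.card F ^ a
        = Fintype.card F ^ a * (Fintype.card F - 1) := fun a => by
      rw [pow_succ, Nat.mul_sub_one]
    rw [e, e] at key
    refine Nat.eq_of_mul_eq_mul_right
      (m := Fintype.card F ^ Module.finrank F K₀ * (Fintype.card F - 1))
      (Nat.mul_pos (by positivity) (by omega)) ?_
    rw [← key, hd, Nat.add_sub_cancel_left, pow_add]
    ring
  · intro x hx
    simp only [mem_filter, mem_univ, true_and] at hx
    have hxm : x ∈ K₀ ⊔ Submodule.span F {x} :=
      Submodule.mem_sup_right (Submodule.mem_span_singleton_self x)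
    have hle : K₀ ⊔ Submodule.span F {x} ≤ E :=
      sup_le (hK₀.trans hHE) ((Submodule.span_singleton_le_iff_mem _ _).2 hx.1)
    have hnle : ¬ K₀ ⊔ Submodule.span F {x} ≤ H := fun h => hx.2 (h hxm)
    rw [card_eq_one]
    refine ⟨K₀ ⊔ Submodule.span F {x}, ?_⟩
    ext K
    simp only [mem_bipartiteAbove, mem_filter, mem_univ, true_and, mem_singleton]
    constructor
    · rintro ⟨⟨hKE, hKH, hK⟩, hxK⟩
      refine (Submodule.eq_of_le_of_finrank_le
        (sup_le (hK ▸ inf_le_left) ((Submodule.span_singleton_le_iff_mem _ _).2 hxK)) ?_).symm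
      rw [finrank_eq_finrank_inf_add_one hHE hfin hKE hKH,
        finrank_eq_finrank_inf_add_one hHE hfin hle hnle, hK, sup_span_inf_eq hK₀ hx.2]
    · rintro rfl
      exact ⟨⟨hle, hnle, sup_span_inf_eq hK₀ hx.2⟩, hxm⟩
  · intro K hK
    simp only [mem_filter, mem_univ, true_and] at hK
    obtain ⟨hKE, hKH, hK⟩ := hK
    have h := hdiff K
    rw [finrank_eq_finrank_inf_add_one hHE hfin hKE hKH, hK] at h
    rw [← h]
    congr 1
    ext x
    simp only [mem_bipartiteBelow, mem_filter, mem_univ, true_and]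
    exact ⟨fun h => ⟨h.2, h.1.2⟩, fun h => ⟨⟨hKE h.1, h.2⟩, h.1⟩⟩

-- Group the `K` by `K ⊓ H`; by `card_inf_eq` all fibres have the same size.
open Classical in
theorem card_filter_of_le {H E T : Submodule F V} (hHE : H ≤ E)
    (hfin : Module.finrank F E = Module.finrank F H + 1) (hTH : T ≤ H)
    (P : Submodule F V → Prop) {a : ℕ} (hP : ∀ K ≤ H, P K → Module.finrank F K = a) :
    #{K : Submodule F V | T ≤ K ∧ K ≤ E ∧ ¬ K ≤ H ∧ P (K ⊓ H)}
      = Fintype.card F ^ (Module.finrank F H - a)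
        * #{K : Submodule F V | T ≤ K ∧ K ≤ H ∧ P K} := by
  rw [card_eq_sum_card_fiberwise (f := fun K => K ⊓ H)
    (t := {K : Submodule F V | T ≤ K ∧ K ≤ H ∧ P K}), mul_comm, ← smul_eq_mul]
  · refine sum_const_nat ?_
    intro K₀ hK₀
    simp only [mem_filter, mem_univ, true_and] at hK₀
    rw [← hP K₀ hK₀.2.1 hK₀.2.2, ← card_inf_eq hHE hfin hK₀.2.1, filter_filter]
    congr 1
    ext K
    simp only [mem_filter, mem_univ, true_and]
    constructor
    · rintro ⟨⟨-, h2, h3, -⟩, h⟩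
      exact ⟨h2, h3, h⟩
    · rintro ⟨h2, h3, rfl⟩
      exact ⟨⟨hK₀.1.trans inf_le_left, h2, h3, hK₀.2.2⟩, rfl⟩
  · intro K hK
    simp only [coe_filter, mem_univ, true_and, Set.mem_ofPred_eq] at hK ⊢
    exact ⟨le_inf hK.1 hTH, inf_le_right, hK.2.2.2⟩

end Subspaces

/-! ### The pivot map for subspaces, from a complete flag. -/

section Pivots

variable {F V : Type*} [Field F] [AddCommGroup V] [Module F V]

theorem exists_flag [FiniteDimensional F V] : ∃ W : ℕ → Submodule F V,
    Monotone W ∧ ∀ i ≤ Module.finrank F V, Module.finrank F (W i) = i := by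
  set n := Module.finrank F V
  let b := Module.finBasis F V
  refine ⟨fun i => Submodule.span F
    (Set.range fun j : Fin (min i n) => b (Fin.castLE (min_le_right i n) j)), ?_, ?_⟩
  · intro i i' h
    refine Submodule.span_mono ?_
    rintro _ ⟨j, rfl⟩
    exact ⟨Fin.castLE (min_le_min_right n h) j, rfl⟩
  · intro i hi
    have h := finrank_span_eq_card
      (b.linearIndependent.comp _ (Fin.castLE_injective (min_le_right i n)))
    rw [Fintype.card_fin] at h
    exact h.trans (min_eq_left hi)

open Classical in
/-- The pivots less than `m` of a subspace with respect to a flag. -/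
def pivots (W : ℕ → Submodule F V) (m : ℕ) (K : Submodule F V) : Finset ℕ :=
  {i ∈ range m | K ⊓ W i ≠ K ⊓ W (i + 1)}

variable {W : ℕ → Submodule F V}

theorem pivots_subset (m : ℕ) (K : Submodule F V) : pivots W m K ⊆ range m :=
  filter_subset _ _

theorem pivots_succ_of_le (hW : Monotone W) {m : ℕ} {K : Submodule F V} (hK : K ≤ W m) :
    pivots W (m + 1) K = pivots W m K := by
  rw [pivots, range_add_one, filter_insert, if_neg]
  · rfl
  · rw [inf_eq_left.2 hK, inf_eq_left.2 (hK.trans (hW (Nat.le_succ m)))]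
    simp

theorem pivots_succ_of_not_le {m : ℕ} {K : Submodule F V} (hK : K ≤ W (m + 1)) (hK' : ¬ K ≤ W m) :
    pivots W (m + 1) K = insert m (pivots W m K) := by
  rw [pivots, range_add_one, filter_insert, if_pos]
  · rfl
  · rw [inf_eq_left.2 hK]
    exact fun h => hK' (inf_eq_left.1 h)

theorem pivots_inf (hW : Monotone W) (m : ℕ) (K : Submodule F V) :
    pivots W m (K ⊓ W m) = pivots W m K := by
  refine filter_congr fun i hi => ?_
  have hi := mem_range.1 hi
  rw [inf_assoc, inf_assoc, inf_eq_right.2 (hW hi.le), inf_eq_right.2 (hW (by omega : i + 1 ≤ m))]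

theorem card_pivots [FiniteDimensional F V] (hW : Monotone W)
    (hfin : ∀ i ≤ Module.finrank F V, Module.finrank F (W i) = i) {m : ℕ}
    (hm : m ≤ Module.finrank F V) {K : Submodule F V} (hK : K ≤ W m) :
    #(pivots W m K) = Module.finrank F K := by
  induction m generalizing K with
  | zero =>
    have h0 : W 0 = ⊥ := Submodule.finrank_eq_zero.1 (hfin 0 (Nat.zero_le _))
    rw [h0, le_bot_iff] at hK
    rw [hK, finrank_bot]
    simp [pivots]
  | succ m ih =>
    by_cases h : K ≤ W m
    · rw [pivots_succ_of_le hW h, ih (by omega) h]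
    · rw [pivots_succ_of_not_le hK h,
        card_insert_of_notMem (notMem_of_subset_range (pivots_subset m K)), ← pivots_inf hW,
        ih (by omega) inf_le_right, ← finrank_eq_finrank_inf_add_one (hW (Nat.le_succ m))
          (by rw [hfin _ hm, hfin _ (by omega)]) hK h]

variable [FiniteDimensional F V] [Fintype F] [Fintype (Submodule F V)]

open Classical in
/-- The number of subspaces above `T` in a Schubert cell. -/
theorem card_filter_pivots (hW : Monotone W)
    (hfin : ∀ i ≤ Module.finrank F V, Module.finrank F (W i) = i) {m : ℕ}
    (hm : m ≤ Module.finrank F V) {T : Submodule F V} (hT : T ≤ W m) {A : Finset ℕ}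
    (hA : A ⊆ range m) :
    #{K : Submodule F V | T ≤ K ∧ K ≤ W m ∧ pivots W m K = A}
      = if pivots W m T ⊆ A
        then Fintype.card F ^ inversions (A \ pivots W m T) (range m \ A) else 0 := by
  induction m generalizing T A with
  | zero =>
    have h0 : W 0 = ⊥ := Submodule.finrank_eq_zero.1 (hfin 0 (Nat.zero_le _))
    rw [h0, le_bot_iff] at hT
    rw [range_zero, subset_empty] at hA
    simp [pivots, hT, hA, h0, filter_eq']
  | succ m ih =>
    have hH : W m ≤ W (m + 1) := hW (Nat.le_succ m)
    have hd : Module.finrank F (W (m + 1)) = Module.finrank F (W m) + 1 := by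
      rw [hfin _ hm, hfin _ (by omega)]
    have hmT : m ∉ pivots W m T := notMem_of_subset_range (pivots_subset m T)
    by_cases hmA : m ∈ A
    · obtain ⟨A, hmA', rfl⟩ : ∃ A', m ∉ A' ∧ A = insert m A' :=
        ⟨A.erase m, notMem_erase m A, (insert_erase hmA).symm⟩
      have hAm : A ⊆ range m := fun x hx => by
        have := mem_range.1 (hA (mem_insert_of_mem hx))
        have : x ≠ m := fun h => hmA' (h ▸ hx)
        exact mem_range.2 (by omega)
      have hr : range (m + 1) \ insert m A = range m \ A := by
        rw [range_add_one, insert_sdiff_insert, sdiff_insert_of_notMem (by simp)]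
      have hset : ∀ K ≤ W (m + 1), (pivots W (m + 1) K = insert m A ↔
          ¬ K ≤ W m ∧ pivots W m (K ⊓ W m) = A) := by
        intro K hK
        have hmK : m ∉ pivots W m K := notMem_of_subset_range (pivots_subset m K)
        rw [pivots_inf hW]
        by_cases h : K ≤ W m
        · rw [pivots_succ_of_le hW h]
          exact iff_of_false (fun h' => hmK (h' ▸ mem_insert_self m A)) fun h' => h'.1 h
        · rw [pivots_succ_of_not_le hK h, and_iff_right h]
          refine ⟨fun h' => ?_, fun h' => by rw [h']⟩
          rw [← erase_insert hmK, h', erase_insert hmA']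
      -- If `T` lies in `W m`, the factor `q ^ (m - #A)` accounts for the inversions that start at
      -- `m`. If not, `m` is already a pivot of `T`, and no new inversion arises.
      by_cases hTm : T ≤ W m
      · have e : #{K : Submodule F V | T ≤ K ∧ K ≤ W (m + 1) ∧ pivots W (m + 1) K = insert m A}
            = Fintype.card F ^ (m - #A)
              * #{K : Submodule F V | T ≤ K ∧ K ≤ W m ∧ pivots W m K = A} := by
          have h := card_filter_of_le hH hd hTm (fun K => pivots W m K = A) (a := #A)
            fun K hK hKA => by rw [← card_pivots hW hfin (by omega) hK, hKA]
          rw [hfin m (by omega)] at h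
          refine Eq.trans (congrArg card ?_) (by convert h)
          ext K
          simp only [mem_filter, mem_univ, true_and]
          exact and_congr_right fun _ => and_congr_right fun h => hset K h
        rw [e, ih (by omega) hTm hAm, pivots_succ_of_le hW hTm, hr]
        simp only [subset_insert_iff_of_notMem hmT]
        rw [insert_sdiff_of_notMem _ hmT, mul_ite, mul_zero,
          inversions_insert_left (fun x hx => mem_range.1 (hAm (sdiff_subset hx)))
            (fun y hy => mem_range.1 (sdiff_subset hy)), card_sdiff_of_subset hAm, card_range,
          pow_add]
      · have e : #{K : Submodule F V | T ≤ K ∧ K ≤ W (m + 1) ∧ pivots W (m + 1) K = insert m A}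
            = #{K : Submodule F V | T ⊓ W m ≤ K ∧ K ≤ W m ∧ pivots W m K = A} := by
          have h := card_filter_of_not_le hH hd hT hTm (fun K => pivots W m K = A)
          refine Eq.trans (congrArg card ?_) (by convert h)
          ext K
          simp only [mem_filter, mem_univ, true_and]
          refine and_congr_right fun hTK => and_congr_right fun h => ?_
          rw [hset K h, and_iff_right fun h' => hTm (hTK.trans h')]
        rw [e, ih (by omega) inf_le_right hAm, pivots_inf hW, pivots_succ_of_not_le hT hTm, hr]
        simp only [insert_subset_insert_iff hmT]
        rw [insert_sdiff_insert, sdiff_insert_of_notMem hmA']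
    · have hAm : A ⊆ range m := fun x hx => by
        have := mem_range.1 (hA hx)
        have : x ≠ m := fun h => hmA (h ▸ hx)
        exact mem_range.2 (by omega)
      -- As `m ∉ A`, the whole cell lies in the hyperplane `W m`.
      have hle : ∀ K ≤ W (m + 1), pivots W (m + 1) K ⊆ A → K ≤ W m := fun K hK hKA => by
        by_contra h
        rw [pivots_succ_of_not_le hK h] at hKA
        exact hmA (hKA (mem_insert_self _ _))
      by_cases hTm : T ≤ W m
      · have hr : range (m + 1) \ A = insert m (range m \ A) := by
          rw [range_add_one, insert_sdiff_of_notMem _ hmA]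
        rw [pivots_succ_of_le hW hTm, hr, inversions_insert_right
          (fun x hx => mem_range.1 (hAm (sdiff_subset hx))), ← ih (by omega) hTm hAm]
        congr 1
        ext K
        simp only [mem_filter, mem_univ, true_and]
        refine and_congr_right fun _ => ⟨fun h => ?_, fun h => ?_⟩
        · have hK := hle K h.1 h.2.le
          exact ⟨hK, by rw [← pivots_succ_of_le hW hK]; exact h.2⟩
        · exact ⟨h.1.trans hH, by rw [pivots_succ_of_le hW h.1]; exact h.2⟩
      · rw [if_neg fun h => hTm (hle T hT h), card_eq_zero, filter_eq_empty_iff]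
        rintro K - ⟨hTK, hK, hKA⟩
        exact hTm (hTK.trans (hle K hK hKA.le))

theorem isPivotMap_spaceRank (hW : Monotone W)
    (hfin : ∀ i ≤ Module.finrank F V, Module.finrank F (W i) = i) :
    IsPivotMap (spaceRank F V) (Module.finrank F V) (Fintype.card F)
      (pivots W (Module.finrank F V)) := by
  have htop : W (Module.finrank F V) = ⊤ := Submodule.eq_top_of_finrank_eq (hfin _ le_rfl)
  refine ⟨pivots_subset _, fun U => card_pivots hW hfin le_rfl (htop ▸ le_top), fun T A hA => ?_⟩
  rw [← card_filter_pivots hW hfin le_rfl (htop ▸ le_top) hA]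
  congr 1
  ext K
  simp [htop]

end Pivots

end CameronLiebler

end

theorem lemma4p8 (n k t : ℕ) (hkn : k ≤ n) (htk : t ≤ k)
    (hdiv : ∀ i < t, k - i ∣ n - i) :
    -- the gcd, for `q = 1` and for every prime power `q`
    (∀ q : ℕ, q = 1 ∨ IsPrimePow q →
      (Finset.range (t + 1)).gcd (fun i => CameronLiebler.qBinom q (n - i) (k - i))
        = CameronLiebler.qBinom q (n - t) (k - t)) ∧
    -- the minimum size
    (2 * k ≤ n →
      -- set case, `q = 1`
      (∀ (V : Type*) [Fintype V], Fintype.card V = n →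
        IsLeast (CameronLiebler.nonemptySizes (CameronLiebler.setRank V) k t)
          (CameronLiebler.qBinom 1 (n - t) (k - t)) ∧
        (1 ≤ t → IsLeast (CameronLiebler.properSizes (CameronLiebler.setRank V) k t)
          (CameronLiebler.qBinom 1 (n - t) (k - t)))) ∧
      -- vector space case, `q` the number of elements of the field
      (∀ (F : Type*) [Field F] [Fintype F] (V : Type*) [AddCommGroup V] [Module F V]
        [FiniteDimensional F V], Module.finrank F V = n →
        IsLeast (CameronLiebler.nonemptySizes (CameronLiebler.spaceRank F V) k t)
          (CameronLiebler.qBinom (Fintype.card F) (n - t) (k - t)) ∧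
        (1 ≤ t → IsLeast (CameronLiebler.properSizes (CameronLiebler.spaceRank F V) k t)
          (CameronLiebler.qBinom (Fintype.card F) (n - t) (k - t))))) := by
  refine ⟨fun q _ => CameronLiebler.gcd_qBinom q hkn htk hdiv, fun h2 => ⟨?_, ?_⟩⟩
  · intro V _ hV
    exact (CameronLiebler.isPivotMap_setRank (Fintype.equivFinOfCardEq hV)).isLeast_sizes one_pos
      (Finset.card_univ.trans hV) Finset.card_empty htk h2 hdiv
  · intro F _ _ V _ _ _ hV
    have : Finite V := Module.finite_of_finite F
    let _ : Fintype (Submodule F V) := Fintype.ofFinite _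
    obtain ⟨W, hW, hfin⟩ := CameronLiebler.exists_flag (F := F) (V := V)
    subst hV
    exact (CameronLiebler.isPivotMap_spaceRank hW hfin).isLeast_sizes Fintype.card_pos
      (finrank_top F V) (finrank_bot F V) htk h2 hdiv
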